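/- Let $G=(V,E)$ be a finite simple (not necessarily bipartite) graph and let $0<p\le 1$. A realization $G_p=(V,E_p)$ of $G$ is the random subgraph obtained by keeping each edge of $G$ independently with probability $p$. Let $\mathrm{OPT}$ be the expected number of edges of a maximum matching of $G_p$. For an integer $b\ge 1$, a simple $b$-matching of $G$ is a subgraph of $G$ in which every vertex has degree at most $b$; its size is its number of edges. Then $G$ contains a simple $\lfloor 1/p\rfloor$-matching with at least $(\lfloor 1/p\rfloor-1)\cdot\mathrm{OPT}$ edges. -/

import Mathlib

namespace StochasticMatching

/-- The law of a realization `G_p` of `G`: every edge of `G` is kept independently with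
probability `p`, and the vertex set is unchanged. -/
noncomputable def realization {V : Type*} (G : SimpleGraph V) (p : unitInterval) :
    MeasureTheory.Measure (SimpleGraph V) :=
  (ProbabilityTheory.setBernoulli G.edgeSet p).map SimpleGraph.fromEdgeSet

/-- The maximum number of edges of a matching of a (finite) graph. -/
noncomputable def matchingNumber {V : Type*} (G : SimpleGraph V) : ℕ :=
  sSup {n : ℕ | ∃ M : G.Subgraph, M.IsMatching ∧ M.edgeSet.ncard = n}

/-- The expected maximum matching size of a realization of `G`. -/
noncomputable def opt {V : Type*} (G : SimpleGraph V) (p : unitInterval) : ℝ :=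
  ∫ H, (matchingNumber H : ℝ) ∂(realization G p)

/-- `B` is a simple `b`-matching of `G`: a subgraph of `G` in which every vertex has degree
at most `b`. -/
def IsSimpleBMatching {V : Type*} (G : SimpleGraph V) (b : ℕ) (B : SimpleGraph V) : Prop :=
  B ≤ G ∧ ∀ v : V, (B.neighborSet v).encard ≤ b

/-- The realization law is a probability measure. -/
theorem isProbabilityMeasure_realization {V : Type*} [Finite V] (G : SimpleGraph V)
    (p : unitInterval) : MeasureTheory.IsProbabilityMeasure (realization G p) :=
  MeasureTheory.Measure.isProbabilityMeasure_map
    SimpleGraph.measurable_fromEdgeSet.aemeasurable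

/-- Every one-point set of graphs on a finite vertex set is measurable. -/
theorem measurableSingletonClass_simpleGraph {V : Type*} [Finite V] :
    MeasurableSingletonClass (SimpleGraph V) where
  measurableSet_singleton H := by
    have h : ({H} : Set (SimpleGraph V)) = SimpleGraph.edgeSet ⁻¹' {H.edgeSet} := by
      ext K; simp
    rw [h]
    exact SimpleGraph.measurableEmbedding_edgeSet.measurable (Set.toFinite _).measurableSet

/-- The integral that defines `opt` is a genuine expectation. -/
theorem integrable_matchingNumber {V : Type*} [Finite V] (G : SimpleGraph V)
    (p : unitInterval) :
    MeasureTheory.Integrable (fun H => (matchingNumber H : ℝ)) (realization G p) := by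
  have := isProbabilityMeasure_realization G p
  have := measurableSingletonClass_simpleGraph (V := V)
  exact MeasureTheory.Integrable.of_finite

/-- The supremum that defines `matchingNumber` is a maximum. -/
theorem isGreatest_matchingNumber {V : Type*} [Finite V] (G : SimpleGraph V) :
    IsGreatest {n : ℕ | ∃ M : G.Subgraph, M.IsMatching ∧ M.edgeSet.ncard = n}
      (matchingNumber G) := by
  have hne : {n : ℕ | ∃ M : G.Subgraph, M.IsMatching ∧ M.edgeSet.ncard = n}.Nonempty :=
    ⟨0, ⊥, by intro v hv; simp at hv, by simp⟩
  have hbd : BddAbove {n : ℕ | ∃ M : G.Subgraph, M.IsMatching ∧ M.edgeSet.ncard = n} := by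
    refine ⟨G.edgeSet.ncard, ?_⟩
    rintro n ⟨M, -, rfl⟩
    exact Set.ncard_le_ncard M.edgeSet_subset (Set.toFinite _)
  exact ⟨Nat.sSup_mem hne hbd, fun n hn => le_csSup hbd hn⟩

end StochasticMatching

/-!
Let `x e` be the probability that the edge `e` lies in a fixed maximum matching of the realization.
Then `x` is a fractional matching of weight `OPT` with `x e ≤ p`, so for `k = ⌊1 / p⌋ - 1` the
weights `k * x` lie in `[0, 1]`, have degree at most `k` at every vertex and total weight `k * OPT`.

These weights are rounded to `0` and `1` by the iterative argument of Beck and Fiala. A vertex is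
overloaded if it meets more than `k + 1` edges of nonzero weight; as its weighted degree is at most
`k`, it meets at least three fractional edges. Every edge has two ends, so there are fewer
overloaded vertices than fractional edges, and the weights can be moved along a line that preserves
the degree of every overloaded vertex, without decreasing the total weight, until a fractional edge
becomes integral. A vertex that is not overloaded has final degree at most `k + 1` whatever happens
later.
-/

namespace StochasticMatching

open MeasureTheory ProbabilityTheory
open scoped Finset

section Rounding

variable {𝕜 V E : Type*}

lemma exists_ne_zero_map_eq_zero_of_finrank_lt_card {K M : Type*} [DivisionRing K]
    [AddCommGroup M] [Module K M] [FiniteDimensional K M] (f : (E → K) →ₗ[K] M) {F : Finset E}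
    (hF : Module.finrank K M < #F) :
    ∃ d : E → K, d ≠ 0 ∧ (∀ e ∉ F, d e = 0) ∧ f d = 0 := by
  let extendByZero := Function.ExtendByZero.linearMap K ((↑) : F → E)
  have hker : LinearMap.ker (f ∘ₗ extendByZero) ≠ ⊥ :=
    LinearMap.ker_ne_bot_of_finrank_lt (by simpa using hF)
  obtain ⟨c, hc, hc0⟩ := (Submodule.ne_bot_iff _).1 hker
  refine ⟨extendByZero c, fun h => hc0 ?_, fun e he => ?_, hc⟩
  · exact Function.extend_injective Subtype.val_injective (0 : E → K)
      (h.trans (map_zero extendByZero).symm)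
  · exact Function.extend_apply' _ _ _ (by simpa using he)

variable [Field 𝕜] [LinearOrder 𝕜]

section NearFeasible

variable [Fintype E] {I : V → E → Prop} [∀ v, DecidablePred (I v)] {k : V → ℕ} {r : ℕ}
  {y z : E → 𝕜}

/-- The edges whose weight still has to be rounded; for weights in `[0, 1]`, those of weight in
`(0, 1)`. -/
def fractional (y : E → 𝕜) : Finset E := {e | y e ≠ 0 ∧ y e ≠ 1}

@[simp]
lemma mem_fractional {e : E} : e ∈ fractional y ↔ y e ≠ 0 ∧ y e ≠ 1 := by
  simp [fractional]

/-- The invariant of the rounding procedure, for a hypergraph with incidence relation `I` whose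
edges carry weights `y`. A vertex violating its weighted degree bound `k v` is allowed as soon as it
meets at most `k v + r` edges of nonzero weight: edges of weight zero are never changed, so its
final degree cannot exceed `k v + r`. -/
structure IsNearFeasible (I : V → E → Prop) [∀ v, DecidablePred (I v)] (k : V → ℕ) (r : ℕ)
    (y : E → 𝕜) : Prop where
  mem_Icc : ∀ e, y e ∈ Set.Icc 0 1
  degree : ∀ v, ∑ e with I v e, y e ≤ k v ∨ #{e | I v e ∧ y e ≠ 0} ≤ k v + r

lemma IsNearFeasible.of_degree_eq (hy : IsNearFeasible I k r y) (hz : ∀ e, z e ∈ Set.Icc 0 1)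
    (hzero : ∀ e, y e = 0 → z e = 0)
    (hdeg : ∀ v, k v + r < #{e | I v e ∧ y e ≠ 0} →
      ∑ e with I v e, z e = ∑ e with I v e, y e) : IsNearFeasible I k r z where
  mem_Icc := hz
  degree v := by
    rcases lt_or_ge (k v + r) #{e | I v e ∧ y e ≠ 0} with hv | hv
    · exact .inl (hdeg v hv ▸ (hy.degree v).resolve_right hv.not_ge)
    · refine .inr ((Finset.card_le_card fun e => ?_).trans hv)
      simpa using fun hI hne => ⟨hI, mt (hzero e) hne⟩

end NearFeasible

variable [IsStrictOrderedRing 𝕜]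

lemma exists_exit_time {y d : 𝕜} (hy : y ∈ Set.Icc 0 1) (hd : d ≠ 0) :
    ∃ τ : 𝕜, 0 ≤ τ ∧ (∀ t ∈ Set.Icc 0 τ, y + t * d ∈ Set.Icc 0 1) ∧
      (y + τ * d = 0 ∨ y + τ * d = 1) := by
  obtain ⟨hy0, hy1⟩ := hy
  rcases hd.lt_or_gt with hneg | hpos
  · have hexit : y + y / -d * d = 0 := by field_simp; ring
    refine ⟨y / -d, div_nonneg hy0 (by linarith), fun t ht => ⟨?_, ?_⟩, .inl hexit⟩
    · linarith [mul_le_mul_of_nonpos_right ht.2 hneg.le]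
    · linarith [mul_nonpos_of_nonneg_of_nonpos ht.1 hneg.le]
  · have hexit : y + (1 - y) / d * d = 1 := by field_simp; ring
    refine ⟨(1 - y) / d, div_nonneg (by linarith) hpos.le, fun t ht => ⟨?_, ?_⟩, .inr hexit⟩
    · linarith [mul_nonneg ht.1 hpos.le]
    · linarith [mul_le_mul_of_nonneg_right ht.2 hpos.le]

lemma exists_add_smul_mem_boundary [Finite E] {y d : E → 𝕜} (hy : ∀ e, y e ∈ Set.Icc 0 1)
    (hd : d ≠ 0) :
    ∃ t : 𝕜, 0 ≤ t ∧ (∀ e, (y + t • d) e ∈ Set.Icc 0 1) ∧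
      ∃ e, d e ≠ 0 ∧ ((y + t • d) e = 0 ∨ (y + t • d) e = 1) := by
  choose τ hτ0 hτ hexit using fun e : {e // d e ≠ 0} => exists_exit_time (hy e) e.2
  obtain ⟨e₀, he₀⟩ := Function.ne_iff.1 hd
  have : Nonempty {e // d e ≠ 0} := ⟨e₀, he₀⟩
  obtain ⟨m, hm⟩ := Finite.exists_min τ
  refine ⟨τ m, hτ0 m, fun e => ?_, m, m.2, hexit m⟩
  by_cases he : d e = 0
  · simpa [he] using hy e
  · exact hτ ⟨e, he⟩ (τ m) ⟨hτ0 m, hm ⟨e, he⟩⟩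

-- The total defect `∑ (1 - y e)` of the nonzero weights is at least `r + 1`, and only the
-- fractional ones contribute to it, each less than `1`.
lemma add_two_le_card_filter_ne_zero_ne_one {s : Finset E} {n r : ℕ} {y : E → 𝕜}
    (hy : ∀ e ∈ s, 0 ≤ y e) (hsum : ∑ e ∈ s, y e ≤ n) (hcard : n + r < #{e ∈ s | y e ≠ 0}) :
    r + 2 ≤ #{e ∈ s | y e ≠ 0 ∧ y e ≠ 1} := by
  set F : Finset E := {e ∈ s | y e ≠ 0 ∧ y e ≠ 1} with hF
  have hdefect : ∑ e ∈ F, (1 - y e) = #{e ∈ s | y e ≠ 0} - ∑ e ∈ s, y e := by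
    calc ∑ e ∈ F, (1 - y e)
        = ∑ e ∈ s with y e ≠ 0, (1 - y e) := by
          rw [hF, ← Finset.filter_filter]
          exact Finset.sum_filter_of_ne fun e _ h h1 => h (by rw [h1, sub_self])
      _ = _ := by simp [Finset.sum_sub_distrib, Finset.sum_filter_ne_zero]
  have hlow : (r + 1 : 𝕜) ≤ ∑ e ∈ F, (1 - y e) := by
    have : (n + r + 1 : 𝕜) ≤ #{e ∈ s | y e ≠ 0} := by exact_mod_cast hcard
    linarith
  have hne : F.Nonempty :=
    Finset.nonempty_of_sum_ne_zero (ne_of_gt ((Nat.cast_add_one_pos r).trans_le hlow))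
  have hlt : ∑ e ∈ F, (1 - y e) < #F := by
    rw [← nsmul_one, ← Finset.sum_const]
    refine Finset.sum_lt_sum_of_nonempty hne fun e he => ?_
    obtain ⟨hes, he0, -⟩ := Finset.mem_filter.1 he
    exact sub_lt_self 1 ((hy e hes).lt_of_ne' he0)
  exact_mod_cast hlow.trans_lt hlt

variable [Fintype E] {I : V → E → Prop} [∀ v, DecidablePred (I v)] {k : V → ℕ} {r : ℕ}
  {y : E → 𝕜}

namespace IsNearFeasible

lemma add_two_le_card_fractional (hy : IsNearFeasible I k r y) {v : V}
    (hv : k v + r < #{e | I v e ∧ y e ≠ 0}) : r + 2 ≤ #{e ∈ fractional y | I v e} := by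
  rw [fractional, Finset.filter_comm]
  exact add_two_le_card_filter_ne_zero_ne_one (fun e _ => (hy.mem_Icc e).1)
    ((hy.degree v).resolve_right hv.not_ge) (by rwa [Finset.filter_filter])

variable [Fintype V]

lemma card_overloaded_lt_card_fractional (hI : ∀ e, #{v | I v e} ≤ r + 1)
    (hy : IsNearFeasible I k r y) (hF : (fractional y).Nonempty) :
    #{v | k v + r < #{e | I v e ∧ y e ≠ 0}} < #(fractional y) := by
  set W : Finset V := {v | k v + r < #{e | I v e ∧ y e ≠ 0}}
  have hcount : #W * (r + 2) ≤ #(fractional y) * (r + 1) :=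
    Finset.card_mul_le_card_mul I
      (fun v hv => hy.add_two_le_card_fractional (Finset.mem_filter.1 hv).2)
      fun e _ => (Finset.card_le_card (Finset.filter_subset_filter _ W.subset_univ)).trans (hI e)
  by_contra! hle
  nlinarith [hF.card_pos]

lemma exists_direction_degree_eq_zero (hI : ∀ e, #{v | I v e} ≤ r + 1)
    (hy : IsNearFeasible I k r y) (hF : (fractional y).Nonempty) (w : E → 𝕜) :
    ∃ d : E → 𝕜, d ≠ 0 ∧ (∀ e ∉ fractional y, d e = 0) ∧
      (∀ v, k v + r < #{e | I v e ∧ y e ≠ 0} → ∑ e with I v e, d e = 0) ∧ 0 ≤ w ⬝ᵥ d := by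
  let W := {v // k v + r < #{e | I v e ∧ y e ≠ 0}}
  let degrees : (E → 𝕜) →ₗ[𝕜] (W → 𝕜) :=
    LinearMap.pi fun v => ∑ e with I v e, LinearMap.proj e
  obtain ⟨d, hd0, hdF, hd⟩ := exists_ne_zero_map_eq_zero_of_finrank_lt_card degrees
    (F := fractional y) (by
      simpa [W, Fintype.card_subtype] using hy.card_overloaded_lt_card_fractional hI hF)
  have hdeg (v : V) (hv : k v + r < #{e | I v e ∧ y e ≠ 0}) : ∑ e with I v e, d e = 0 := by
    simpa [degrees] using congrFun hd ⟨v, hv⟩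
  rcases le_total 0 (w ⬝ᵥ d) with hw | hw
  · exact ⟨d, hd0, hdF, hdeg, hw⟩
  · refine ⟨-d, neg_ne_zero.2 hd0, fun e he => ?_, fun v hv => ?_, ?_⟩
    · simp [hdF e he]
    · simp [hdeg v hv]
    · simpa using hw

lemma exists_card_fractional_lt (hI : ∀ e, #{v | I v e} ≤ r + 1) (hy : IsNearFeasible I k r y)
    (hF : (fractional y).Nonempty) (w : E → 𝕜) :
    ∃ z : E → 𝕜, IsNearFeasible I k r z ∧ (∀ e, y e = 0 → z e = 0) ∧
      #(fractional z) < #(fractional y) ∧ w ⬝ᵥ y ≤ w ⬝ᵥ z := by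
  obtain ⟨d, hd0, hdF, hdeg, hw⟩ := hy.exists_direction_degree_eq_zero hI hF w
  obtain ⟨t, ht, hIcc, e₀, hde₀, hint⟩ := exists_add_smul_mem_boundary hy.mem_Icc hd0
  have hfix (e : E) (he : e ∉ fractional y) : (y + t • d) e = y e := by simp [hdF e he]
  have hzero (e : E) (he : y e = 0) : (y + t • d) e = 0 := by
    rw [hfix e (by simp [he]), he]
  refine ⟨y + t • d, hy.of_degree_eq hIcc hzero fun v hv => ?_, hzero, ?_, ?_⟩
  · simp [Finset.sum_add_distrib, ← Finset.mul_sum, hdeg v hv]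
  · have hsub : fractional (y + t • d) ⊆ fractional y := fun e he => by
      by_contra hne
      rw [mem_fractional, hfix e hne] at he
      exact hne (mem_fractional.2 he)
    have he₀ : e₀ ∈ fractional y := by_contra fun h => hde₀ (hdF e₀ h)
    exact Finset.card_lt_card (Finset.ssubset_iff_of_subset hsub |>.2
      ⟨e₀, he₀, fun h => hint.elim (mem_fractional.1 h).1 (mem_fractional.1 h).2⟩)
  · rw [dotProduct_add, dotProduct_smul]
    exact le_add_of_nonneg_right (mul_nonneg ht hw)

lemma exists_fractional_eq_empty (hI : ∀ e, #{v | I v e} ≤ r + 1)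
    (hy : IsNearFeasible I k r y) (w : E → 𝕜) :
    ∃ z : E → 𝕜, IsNearFeasible I k r z ∧ (∀ e, y e = 0 → z e = 0) ∧
      fractional z = ∅ ∧ w ⬝ᵥ y ≤ w ⬝ᵥ z := by
  induction hn : #(fractional y) using Nat.strong_induction_on generalizing y with
  | _ n ih =>
    rcases (fractional y).eq_empty_or_nonempty with hF | hF
    · exact ⟨y, hy, fun _ => id, hF, le_rfl⟩
    · obtain ⟨z, hz, hyz, hlt, hwz⟩ := hy.exists_card_fractional_lt hI hF w
      obtain ⟨x, hx, hzx, hint, hwx⟩ := ih _ (hn ▸ hlt) hz rfl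
      exact ⟨x, hx, fun e he => hzx e (hyz e he), hint, hwz.trans hwx⟩

end IsNearFeasible

theorem exists_finset_degree_le_and_dotProduct_le [Fintype V] (hI : ∀ e, #{v | I v e} ≤ r + 1)
    (hy : ∀ e, y e ∈ Set.Icc 0 1) (hdeg : ∀ v, ∑ e with I v e, y e ≤ k v) (w : E → 𝕜) :
    ∃ S : Finset E, (∀ e ∈ S, y e ≠ 0) ∧ (∀ v, #{e ∈ S | I v e} ≤ k v + r) ∧
      w ⬝ᵥ y ≤ ∑ e ∈ S, w e := by
  obtain ⟨z, hz, hyz, hint, hw⟩ :=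
    IsNearFeasible.exists_fractional_eq_empty hI ⟨hy, fun v => .inl (hdeg v)⟩ w
  refine ⟨({e | z e ≠ 0} : Finset E), fun e he => mt (hyz e) (by simpa using he),
    fun v => ?_, hw.trans_eq ?_⟩
  · rw [Finset.filter_filter]
    simp only [and_comm (b := I v _)]
    by_contra! hv
    simpa [hint] using hz.add_two_le_card_fractional hv
  · have hz01 (e : E) (he : z e ≠ 0) : z e = 1 := by
      by_contra h
      simpa [hint] using mem_fractional.2 ⟨he, h⟩
    rw [dotProduct, Finset.sum_filter]
    refine Finset.sum_congr rfl fun e _ => ?_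
    split_ifs with he
    · rw [hz01 e he, mul_one]
    · rw [not_not.1 he, mul_zero]

end Rounding

section Graph

variable {V : Type*} {G : SimpleGraph V}

lemma subsingleton_incidenceSet_of_isMatching {M : G.Subgraph} (hM : M.IsMatching) (v : V) :
    (M.incidenceSet v).Subsingleton := by
  rintro _ ⟨ha, u, rfl⟩ _ ⟨hb, w, rfl⟩
  rw [hM.eq_of_adj_left (M.mem_edgeSet.1 ha) (M.mem_edgeSet.1 hb)]

lemma isSimpleBMatching_fromEdgeSet {S : Set (Sym2 V)} (hS : S ⊆ G.edgeSet) {b : ℕ}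
    (hdeg : ∀ v, {e ∈ S | v ∈ e}.encard ≤ b) :
    IsSimpleBMatching G b (SimpleGraph.fromEdgeSet S) := by
  refine ⟨fun u v h => hS h.1, fun v => ?_⟩
  have hinj : Set.InjOn (fun u => s(v, u)) ((SimpleGraph.fromEdgeSet S).neighborSet v) :=
    fun _ _ _ _ h => Sym2.congr_right.1 h
  rw [← hinj.encard_image]
  refine (Set.encard_le_encard ?_).trans (hdeg v)
  rintro _ ⟨u, hu, rfl⟩
  exact ⟨hu.1, Sym2.mem_mk_left v u⟩

lemma edgeSet_fromEdgeSet_of_subset {S : Set (Sym2 V)} (hS : S ⊆ G.edgeSet) :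
    (SimpleGraph.fromEdgeSet S).edgeSet = S := by
  rw [SimpleGraph.edgeSet_fromEdgeSet, sdiff_eq_left, Set.disjoint_left]
  exact fun e he => G.not_isDiag_of_mem_edgeSet (hS he)

lemma card_filter_mem_sym2_le_two [Fintype V] [DecidableEq V] (e : Sym2 V) :
    #{v | v ∈ e} ≤ 2 := by
  rw [show ({v | v ∈ e} : Finset V) = e.toFinset by ext; simp, Sym2.card_toFinset]
  split_ifs <;> decide

variable [Finite V]

/-- A maximum matching of `H`, chosen arbitrarily. -/
noncomputable def maximumMatching (H : SimpleGraph V) : H.Subgraph :=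
  (isGreatest_matchingNumber H).1.choose

lemma isMatching_maximumMatching (H : SimpleGraph V) : (maximumMatching H).IsMatching :=
  (isGreatest_matchingNumber H).1.choose_spec.1

lemma ncard_edgeSet_maximumMatching (H : SimpleGraph V) :
    (maximumMatching H).edgeSet.ncard = matchingNumber H :=
  (isGreatest_matchingNumber H).1.choose_spec.2

end Graph

section Probability

lemma sum_measureReal_eq_integral_card {Ω E : Type*} [MeasurableSpace Ω] (μ : Measure Ω)
    [IsFiniteMeasure μ] (s : Finset E) {A : E → Set Ω} (hA : ∀ e ∈ s, MeasurableSet (A e))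
    [∀ ω, DecidablePred fun e => ω ∈ A e] :
    ∑ e ∈ s, μ.real (A e) = ∫ ω, (#{e ∈ s | ω ∈ A e} : ℝ) ∂μ := by
  calc ∑ e ∈ s, μ.real (A e)
      = ∑ e ∈ s, ∫ ω, (A e).indicator 1 ω ∂μ :=
        Finset.sum_congr rfl fun e he => (integral_indicator_one (hA e he)).symm
    _ = ∫ ω, ∑ e ∈ s, (A e).indicator 1 ω ∂μ :=
        (integral_finsetSum _ fun e he => (integrable_const 1).indicator (hA e he)).symm
    _ = _ := by simp [Set.indicator_apply]

lemma setBernoulli_real_mem_le {ι : Type*} (u : Set ι) (p : unitInterval) (i : ι) :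
    (setBernoulli u p).real {s | i ∈ s} ≤ p := by
  classical
  have hcylinder : (fun q : ι → Prop => {j | q j}) ⁻¹' {s | i ∈ s} =
      cylinder {i} ({fun _ => True} : Set (({i} : Finset ι) → Prop)) := by
    ext; simp [funext_iff]
  rw [measureReal_def, setBernoulli_apply', hcylinder]
  by_cases hi : i ∈ u <;> simp [Measure.infinitePi_cylinder, hi, p.2.1]

attribute [local instance] measurableSingletonClass_simpleGraph

variable {V : Type*} {G : SimpleGraph V} {μ : Measure (SimpleGraph V)}

lemma ae_realization_le [Finite V] (G : SimpleGraph V) (p : unitInterval) :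
    ∀ᵐ H ∂realization G p, H ≤ G := by
  rw [realization, ae_map_iff SimpleGraph.measurable_fromEdgeSet.aemeasurable .of_discrete]
  filter_upwards [setBernoulli_ae_subset] with s hs
  exact fun u v h => hs h.1

lemma realization_real_mem_edgeSet_le [Finite V] (G : SimpleGraph V) (p : unitInterval)
    (e : Sym2 V) :
    (realization G p).real {H | e ∈ H.edgeSet} ≤ p := by
  rw [realization, map_measureReal_apply SimpleGraph.measurable_fromEdgeSet .of_discrete]
  refine (measureReal_mono fun s hs => ?_).trans (setBernoulli_real_mem_le G.edgeSet p e)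
  rw [Set.mem_preimage, Set.mem_ofPred_eq, SimpleGraph.edgeSet_fromEdgeSet] at hs
  exact hs.1

/-- The probability that the edge `e` belongs to the chosen maximum matching of a random graph
with law `μ`. -/
noncomputable def matchingProb [Finite V] (μ : Measure (SimpleGraph V)) (e : Sym2 V) : ℝ :=
  μ.real {H | e ∈ (maximumMatching H).edgeSet}

lemma matchingProb_nonneg [Finite V] (e : Sym2 V) : 0 ≤ matchingProb μ e := measureReal_nonneg

lemma matchingProb_le [Finite V] [IsFiniteMeasure μ] (e : Sym2 V) :
    matchingProb μ e ≤ μ.real {H | e ∈ H.edgeSet} :=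
  measureReal_mono fun H h => (maximumMatching H).edgeSet_subset h

lemma matchingProb_eq_zero [Finite V] (hμ : ∀ᵐ H ∂μ, H ≤ G) {e : Sym2 V} (he : e ∉ G.edgeSet) :
    matchingProb μ e = 0 := by
  have hnull : μ {H | e ∈ (maximumMatching H).edgeSet} = 0 := by
    rw [measure_eq_zero_iff_ae_notMem]
    filter_upwards [hμ] with H hH h
    exact he (SimpleGraph.edgeSet_mono hH ((maximumMatching H).edgeSet_subset h))
  rw [matchingProb, measureReal_def, hnull, ENNReal.toReal_zero]

lemma sum_matchingProb_incident_le_one [Fintype V] [DecidableEq V] [IsProbabilityMeasure μ]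
    (v : V) :
    ∑ e with v ∈ e, matchingProb μ e ≤ 1 := by
  classical
  have hcard (H : SimpleGraph V) :
      #{e ∈ ({e | v ∈ e} : Finset (Sym2 V)) | e ∈ (maximumMatching H).edgeSet} ≤ 1 := by
    rw [Finset.card_le_one_iff_subsingleton]
    convert subsingleton_incidenceSet_of_isMatching (isMatching_maximumMatching H) v
    ext e
    simp [SimpleGraph.Subgraph.incidenceSet, and_comm]
  calc ∑ e with v ∈ e, matchingProb μ e
      = ∫ H, (#{e ∈ ({e | v ∈ e} : Finset (Sym2 V)) | e ∈ (maximumMatching H).edgeSet} : ℝ) ∂μ :=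
        sum_measureReal_eq_integral_card μ _ fun _ _ => .of_discrete
    _ ≤ ∫ _, 1 ∂μ :=
        integral_mono .of_finite .of_finite fun H => Nat.cast_le_one.2 (hcard H)
    _ = 1 := by simp

lemma sum_matchingProb [Fintype V] [IsFiniteMeasure μ] :
    ∑ e, matchingProb μ e = ∫ H, (matchingNumber H : ℝ) ∂μ := by
  classical
  calc ∑ e, matchingProb μ e
      = ∫ H, (#{e | e ∈ (maximumMatching H).edgeSet} : ℝ) ∂μ :=
        sum_measureReal_eq_integral_card μ _ fun _ _ => .of_discrete
    _ = _ := by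
        congr! with H
        rw [← ncard_edgeSet_maximumMatching, ← Set.ncard_coe_finset]
        simp

end Probability

lemma exists_natFloor_one_div_eq_succ {p : ℝ} (hp0 : 0 < p) (hp1 : p ≤ 1) :
    ∃ k : ℕ, ⌊1 / p⌋₊ = k + 1 ∧ k * p ≤ 1 := by
  obtain ⟨k, hfloor⟩ : ∃ k, ⌊1 / p⌋₊ = k + 1 :=
    Nat.exists_eq_add_of_le' (Nat.floor_pos.2 (one_le_one_div hp0 hp1))
  refine ⟨k, hfloor, (le_div_iff₀ hp0).1 ((Nat.cast_le.2 ?_).trans (Nat.floor_le (by positivity)))⟩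
  omega

end StochasticMatching

open MeasureTheory StochasticMatching in
theorem mainTheorem2_general {V : Type*} [Finite V] {G : SimpleGraph V}
    {μ : Measure (SimpleGraph V)} [IsProbabilityMeasure μ] (hG : ∀ᵐ H ∂μ, H ≤ G) {k : ℕ}
    (hk : ∀ e, k * μ.real {H | e ∈ H.edgeSet} ≤ 1) :
    ∃ B : SimpleGraph V, IsSimpleBMatching G (k + 1) B ∧
      k * ∫ H, (matchingNumber H : ℝ) ∂μ ≤ B.edgeSet.ncard := by
  classical
  cases nonempty_fintype V
  let y : Sym2 V → ℝ := (k : ℝ) • matchingProb μ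
  have hIcc (e : Sym2 V) : y e ∈ Set.Icc 0 1 :=
    ⟨mul_nonneg k.cast_nonneg (matchingProb_nonneg e),
      (mul_le_mul_of_nonneg_left (matchingProb_le e) k.cast_nonneg).trans (hk e)⟩
  have hdeg (v : V) : ∑ e with v ∈ e, y e ≤ k := by
    simp only [y, Pi.smul_apply, smul_eq_mul, ← Finset.mul_sum]
    exact mul_le_of_le_one_right k.cast_nonneg (sum_matchingProb_incident_le_one v)
  obtain ⟨S, hSy, hSdeg, hsum⟩ :=
    exists_finset_degree_le_and_dotProduct_le card_filter_mem_sym2_le_two hIcc hdeg 1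
  have hSG : (S : Set (Sym2 V)) ⊆ G.edgeSet := fun e he =>
    by_contra fun h => hSy e he (by simp [y, matchingProb_eq_zero hG h])
  refine ⟨SimpleGraph.fromEdgeSet S, isSimpleBMatching_fromEdgeSet hSG fun v => ?_, ?_⟩
  · rw [show {e ∈ (S : Set (Sym2 V)) | v ∈ e} = ({e ∈ S | v ∈ e} : Finset (Sym2 V)) by simp,
      Set.encard_coe_eq_coe_finsetCard]
    exact_mod_cast hSdeg v
  · rw [edgeSet_fromEdgeSet_of_subset hSG, Set.ncard_coe_finset, ← sum_matchingProb]
    simpa [y, one_dotProduct, dotProduct_smul] using hsum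

theorem mainTheorem2 {V : Type*} [Finite V] (G : SimpleGraph V) (p : unitInterval) (hp : 0 < p) :
    ∃ B : SimpleGraph V,
      StochasticMatching.IsSimpleBMatching G ⌊1 / (p : ℝ)⌋₊ B ∧
      ((⌊1 / (p : ℝ)⌋₊ : ℝ) - 1) * StochasticMatching.opt G p ≤ (B.edgeSet.ncard : ℝ) := by
  have := StochasticMatching.isProbabilityMeasure_realization G p
  obtain ⟨k, hfloor, hkp⟩ := StochasticMatching.exists_natFloor_one_div_eq_succ hp p.2.2
  rw [hfloor, Nat.cast_succ, add_sub_cancel_right]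
  exact mainTheorem2_general (StochasticMatching.ae_realization_le G p) fun e =>
    (mul_le_mul_of_nonneg_left (StochasticMatching.realization_real_mem_edgeSet_le G p e)
      k.cast_nonneg).trans hkp
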